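/- **Theorem (general prolongation formula).** Let $X=\mathbb R^p$, $U=\mathbb R^q$, let $M\subseteq X\times U$ be open, and let $$v=\sum_{i=1}^p\xi^i(x,u)\,\partial_{x^i}+\sum_{\alpha=1}^q\phi_\alpha(x,u)\,\partial_{u^\alpha}$$ be a smooth vector field on $M$, the infinitesimal generator of a local one-parameter transformation group $\varepsilon\mapsto \mathrm{Fl}^v_\varepsilon$ on $M$ (its flow): a smooth map $(\varepsilon,m)\mapsto \mathrm{Fl}^v_\varepsilon(m)\in M$ on an open set $\mathcal U\subseteq\mathbb R\times M$ containing $\{0\}\times M$, such that $\mathrm{Fl}^v_0=\mathrm{id}$, $\mathrm{Fl}^v_\varepsilon(\mathrm{Fl}^v_\delta(m))=\mathrm{Fl}^v_{\varepsilon+\delta}(m)$ whenever $(\delta,m)$, $(\varepsilon,\mathrm{Fl}^v_\delta(m))$ and $(\varepsilon+\delta,m)$ lie in $\mathcal U$, $(-\varepsilon,\mathrm{Fl}^v_\varepsilon(m))\in\mathcal U$ whenever $(\varepsilon,m)\in\mathcal U$, and $\frac{d}{d\varepsilon}\big|_0\mathrm{Fl}^v_\varepsilon(m)=v(m)$ for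 all $m\in M$. *Notation.* Multi-indices $J=(j_1,\dots,j_k)$, $1\le j_\kappa\le p$, are unordered and $\sharp J=k$; $(J,i)$ is $J$ with $i$ adjoined. The $n$-th jet space $X\times U^{(n)}$ has coordinates $x^i$ and $u^\alpha_J$, $0\le\sharp J\le n$ (with $u^\alpha_0=u^\alpha$); $M^{(n)}$ is the set of its points with $(x,u)\in M$. For a smooth $U$-valued function $f$ of $x$, $\mathrm{pr}^{(n)}f(x)$ is the point with coordinates $u^\alpha_J=\partial_Jf^\alpha(x)$. For a function $P$ of $(x,u^{(n)})$, its total derivative is the function of $(x,u^{(n+1)})$ $$D_iP=\frac{\partial P}{\partial x^i}+\sum_{\alpha}\sum_{0\le\sharp J\le n}u^\alpha_{J,i}\frac{\partial P}{\partial u^\alpha_J},\qquad D_J=D_{j_1}\cdots D_{j_k}.$$ *Prolongation.* For $(x_0,u_0^{(n)})\in M^{(n)}$ and small $\varepsilon$, put $\mathrm{pr}^{(n)}\mathrm{Fl}^v_\varepsilon(x_0,u_0^{(n)})=(\tilde x_0,\mathrm{pr}^{(n)}\tilde f(\tilde x_0))$, where $f$ is any smooth function on a sufficiently small neighbourhood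 of $x_0$ with $\mathrm{pr}^{(n)}f(x_0)=u_0^{(n)}$, $\tilde f$ is the smooth function whose graph is the image under $\mathrm{Fl}^v_\varepsilon$ of the graph of $f$, and $(\tilde x_0,\tilde u_0)=\mathrm{Fl}^v_\varepsilon(x_0,u_0)$. The $n$-th prolongation of $v$ is $\mathrm{pr}^{(n)}v=\frac{d}{d\varepsilon}\big|_0\mathrm{pr}^{(n)}\mathrm{Fl}^v_\varepsilon$. *Claim.* For every $n\ge0$, the prolongation $\mathrm{pr}^{(n)}v$ is well defined and is the smooth vector field on $M^{(n)}$ $$\mathrm{pr}^{(n)}v=v+\sum_{\alpha=1}^q\ \sum_{1\le\sharp J\le n}\phi_\alpha^J(x,u^{(n)})\,\frac{\partial}{\partial u^\alpha_J},$$ with $$\phi^J_\alpha=D_J\Big(\phi_\alpha-\sum_{i=1}^p\xi^iu^\alpha_i\Big)+\sum_{i=1}^p\xi^iu^\alpha_{J,i}.$$ Here the right-hand side, a priori a function on $M^{(\sharp J+1)}$, does not depend on the coordinates of order $\sharp J+1$ nor on the order in which $J$ is listed. -/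

import Mathlib

open scoped ContDiff Topology

/-! ### Multi-indices, jet spaces, partial derivatives

`X = ℝ^p` and `U = ℝ^q` are realized as `Fin p → ℝ` and `Fin q → ℝ`. -/

/-- Unordered multi-indices `J = (j₁, …, j_k)`, `1 ≤ j_l ≤ p`, of order `k ≤ n`. -/
abbrev MultiIndex (p n : ℕ) : Type := {J : Multiset (Fin p) // J.card ≤ n}

instance MultiIndex.instFinite (p n : ℕ) : Finite (MultiIndex p n) := by
  have : Function.Injective
      (fun J : MultiIndex p n => (⟨⟨J.1.card, Nat.lt_succ_of_le J.2⟩, ⟨J.1, rfl⟩⟩ :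
        Σ k : Fin (n + 1), Sym (Fin p) k)) := by
    intro J K h
    apply Subtype.ext
    have h1 := congrArg (fun s : (Σ k : Fin (n + 1), Sym (Fin p) k) => (s.2 : Multiset (Fin p))) h
    exact h1
  exact Finite.of_injective _ this

noncomputable instance MultiIndex.instFintype (p n : ℕ) : Fintype (MultiIndex p n) :=
  Fintype.ofFinite _

/-- The multi-index `(J, i)`. -/
def MultiIndex.snoc {p n : ℕ} (J : MultiIndex p n) (i : Fin p) : MultiIndex p (n + 1) :=
  ⟨i ::ₘ J.1, by rw [Multiset.card_cons]; exact Nat.succ_le_succ J.2⟩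

/-- The space `X × U` of independent and dependent variables. -/
abbrev BaseSpace (p q : ℕ) : Type := (Fin p → ℝ) × (Fin q → ℝ)

/-- The jet space `X × U^(n)`, with coordinates `x^i` and `u^α_J`, `0 ≤ #J ≤ n`. -/
abbrev JetSpace (p q n : ℕ) : Type := (Fin p → ℝ) × (Fin q → MultiIndex p n → ℝ)

namespace JetSpace

variable {p q : ℕ}

/-- The natural projection `X × U^(n) → X × U^(k)`, `k ≤ n`. -/
def proj {n k : ℕ} (h : k ≤ n) (z : JetSpace p q n) : JetSpace p q k :=
  (z.1, fun α J => z.2 α ⟨J.1, J.2.trans h⟩)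

/-- The natural projection `X × U^(n) → X × U`. -/
def base {n : ℕ} (z : JetSpace p q n) : BaseSpace p q :=
  (z.1, fun α => z.2 α ⟨0, Nat.zero_le n⟩)

/-- `M^(n) = M × U_1 × ⋯ × U_n`, for `M ⊆ X × U`. -/
def jetsOver (M : Set (BaseSpace p q)) (n : ℕ) : Set (JetSpace p q n) := {z | z.base ∈ M}

end JetSpace

/-- `∂h/∂x^i`. -/
noncomputable def partialDeriv {p : ℕ} (i : Fin p) (h : (Fin p → ℝ) → ℝ) : (Fin p → ℝ) → ℝ :=
  fun x => fderiv ℝ h x (Pi.single i 1)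

/-- `∂_{j₁} ∂_{j₂} ⋯ ∂_{j_k} h`. -/
noncomputable def iterPartialDeriv {p : ℕ} (L : List (Fin p)) (h : (Fin p → ℝ) → ℝ) :
    (Fin p → ℝ) → ℝ :=
  L.foldr partialDeriv h

/-- The point `(x, pr^(n) f(x))` of the jet space, where `u^α_J = ∂_J f^α(x)`. (For smooth `f` the
order in which the elements of `J` are listed is irrelevant, see `iterPartialDeriv_perm`.) -/
noncomputable def jetAt {p q : ℕ} (n : ℕ) (f : (Fin p → ℝ) → Fin q → ℝ) (x : Fin p → ℝ) :
    JetSpace p q n :=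
  (x, fun α J => iterPartialDeriv J.1.toList (fun y => f y α) x)

/-! ### Total derivatives -/

/-- The total derivative
`D_i P = ∂P/∂x^i + ∑_α ∑_{#J ≤ n} u^α_{J,i} ∂P/∂u^α_J`, a function on the `(n+1)`-st jet space.
See `totalDeriv_jetAt` for its characteristic property. -/
noncomputable def totalDeriv {p q n : ℕ} (i : Fin p) (P : JetSpace p q n → ℝ) :
    JetSpace p q (n + 1) → ℝ := fun w =>
  fderiv ℝ P (w.proj n.le_succ) (Pi.single i 1, 0) +
    ∑ α : Fin q, ∑ J : MultiIndex p n,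
      w.2 α (J.snoc i) * fderiv ℝ P (w.proj n.le_succ) (0, Pi.single α (Pi.single J 1))

/-- `D_J = D_{j₁} D_{j₂} ⋯ D_{j_k}` for `J = (j₁, …, j_k)`. -/
noncomputable def iterTotalDeriv {p q n : ℕ} :
    (L : List (Fin p)) → (JetSpace p q n → ℝ) → (JetSpace p q (n + L.length) → ℝ)
  | [], P => P
  | j :: L, P => totalDeriv j (iterTotalDeriv L P)

section TotalDerivative

variable {p q : ℕ} {Ω : Set (Fin p → ℝ)}

theorem partialDeriv_contDiffOn (hΩ : IsOpen Ω) (i : Fin p) {h : (Fin p → ℝ) → ℝ}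
    (hh : ContDiffOn ℝ ∞ h Ω) : ContDiffOn ℝ ∞ (partialDeriv i h) Ω :=
  (hh.fderiv_of_isOpen hΩ (m := ∞) (by simp)).clm_apply contDiffOn_const

theorem iterPartialDeriv_contDiffOn (hΩ : IsOpen Ω) (L : List (Fin p)) {h : (Fin p → ℝ) → ℝ}
    (hh : ContDiffOn ℝ ∞ h Ω) : ContDiffOn ℝ ∞ (iterPartialDeriv L h) Ω := by
  induction L with
  | nil => exact hh
  | cons j L ih => exact partialDeriv_contDiffOn hΩ j ih

theorem partialDeriv_congr (hΩ : IsOpen Ω) (i : Fin p) {h k : (Fin p → ℝ) → ℝ}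
    (hhk : Set.EqOn h k Ω) : Set.EqOn (partialDeriv i h) (partialDeriv i k) Ω := by
  intro x hx
  have : h =ᶠ[𝓝 x] k := Filter.eventuallyEq_of_mem (hΩ.mem_nhds hx) hhk
  simp only [partialDeriv, this.fderiv_eq]

theorem partialDeriv_comm (hΩ : IsOpen Ω) (i j : Fin p) {h : (Fin p → ℝ) → ℝ}
    (hh : ContDiffOn ℝ ∞ h Ω) :
    Set.EqOn (partialDeriv i (partialDeriv j h)) (partialDeriv j (partialDeriv i h)) Ω := by
  intro x hx
  have hx' : ContDiffAt ℝ ∞ h x := hh.contDiffAt (hΩ.mem_nhds hx)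
  have hs : IsSymmSndFDerivAt ℝ h x := hx'.isSymmSndFDerivAt
    (by rw [minSmoothness_of_isRCLikeNormedField]; exact WithTop.coe_le_coe.2 le_top)
  have hd : DifferentiableAt ℝ (fderiv ℝ h) x :=
    ((hh.fderiv_of_isOpen hΩ (m := ∞) (by simp)).contDiffAt (hΩ.mem_nhds hx)).differentiableAt
      (by simp)
  have key : ∀ a b : Fin p, partialDeriv a (partialDeriv b h) x =
      fderiv ℝ (fderiv ℝ h) x (Pi.single a 1) (Pi.single b 1) := by
    intro a b
    have h1 := (hd.hasFDerivAt.clm_apply (hasFDerivAt_const (Pi.single b (1 : ℝ)) x)).fderiv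
    unfold partialDeriv
    rw [h1]
    simp
  rw [key, key]
  exact hs _ _

theorem iterPartialDeriv_perm (hΩ : IsOpen Ω) {L L' : List (Fin p)} (hL : L.Perm L')
    {h : (Fin p → ℝ) → ℝ} (hh : ContDiffOn ℝ ∞ h Ω) :
    Set.EqOn (iterPartialDeriv L h) (iterPartialDeriv L' h) Ω := by
  induction hL with
  | nil => exact fun _ _ => rfl
  | cons j _ ih => exact partialDeriv_congr hΩ j ih
  | swap j k L => exact partialDeriv_comm hΩ k j (iterPartialDeriv_contDiffOn hΩ L hh)
  | trans _ _ ih₁ ih₂ => exact ih₁.trans ih₂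

/-- The characteristic property of `D_i P`:
`D_i P (x, pr^(n+1) f(x)) = ∂/∂x^i [P (x, pr^(n) f(x))]` for every smooth function `f`. -/
theorem totalDeriv_jetAt {n : ℕ} (hΩ : IsOpen Ω) {f : (Fin p → ℝ) → Fin q → ℝ}
    (hf : ContDiffOn ℝ ∞ f Ω) {x : Fin p → ℝ} (hx : x ∈ Ω) (i : Fin p) {P : JetSpace p q n → ℝ}
    (hP : DifferentiableAt ℝ P (jetAt n f x)) :
    totalDeriv i P (jetAt (n + 1) f x) = partialDeriv i (fun y => P (jetAt n f y)) x := by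
  classical
  have hfα : ∀ α, ContDiffOn ℝ ∞ (fun y => f y α) Ω := fun α => contDiffOn_pi.1 hf α
  have hc : ∀ (α : Fin q) (J : MultiIndex p n), DifferentiableAt ℝ
      (fun y => iterPartialDeriv J.1.toList (fun y => f y α) y) x := fun α J =>
    ((iterPartialDeriv_contDiffOn hΩ J.1.toList (hfα α)).contDiffAt
      (hΩ.mem_nhds hx)).differentiableAt (by simp)
  have h2 : HasFDerivAt (fun y => (jetAt n f y).2)
      (ContinuousLinearMap.pi fun α => ContinuousLinearMap.pi fun J : MultiIndex p n =>
        fderiv ℝ (iterPartialDeriv J.1.toList (fun y => f y α)) x) x :=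
    hasFDerivAt_pi.2 fun α => hasFDerivAt_pi.2 fun J => (hc α J).hasFDerivAt
  have h3 : HasFDerivAt (fun y => jetAt n f y) _ x := (hasFDerivAt_id x).prodMk h2
  have h4 := (hP.hasFDerivAt.comp x h3).fderiv
  have hproj : (jetAt (n + 1) f x).proj n.le_succ = jetAt n f x := rfl
  have hsnoc : ∀ (α : Fin q) (J : MultiIndex p n), (jetAt (n + 1) f x).2 α (J.snoc i) =
      partialDeriv i (iterPartialDeriv J.1.toList (fun y => f y α)) x := by
    intro α J
    refine iterPartialDeriv_perm (L' := i :: J.1.toList) hΩ ?_ (hfα α) hx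
    rw [← Multiset.coe_eq_coe, Multiset.coe_toList, ← Multiset.cons_coe, Multiset.coe_toList]
    rfl
  have hR : partialDeriv i (fun y => P (jetAt n f y)) x = fderiv ℝ P (jetAt n f x)
      (Pi.single i 1, fun α J => (jetAt (n + 1) f x).2 α (J.snoc i)) := by
    simp only [hsnoc]
    exact congrArg (fun T : (Fin p → ℝ) →L[ℝ] ℝ => T (Pi.single i 1)) h4
  rw [hR]
  have hdec : ((Pi.single i 1, fun α J => (jetAt (n + 1) f x).2 α (J.snoc i)) : JetSpace p q n) =
      (Pi.single i 1, 0) + ∑ α : Fin q, ∑ J : MultiIndex p n,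
        (jetAt (n + 1) f x).2 α (J.snoc i) •
          ((0, Pi.single α (Pi.single J 1)) : JetSpace p q n) := by
    refine Prod.ext ?_ ?_
    · simp [Prod.fst_sum]
    · funext β K
      simp [Prod.snd_sum, Finset.sum_apply, Pi.single_apply, Finset.sum_ite_eq]
  rw [hdec, map_add, map_sum]
  simp only [map_sum, map_smul, smul_eq_mul]
  rfl

end TotalDerivative

/-! ### Local one-parameter transformation groups and their prolongations -/

/-- A local one-parameter transformation group (a local transformation group of `(ℝ, +)`) on an
open subset `M` of a normed space: a smooth partial action, defined on an open set
`dom ⊆ ℝ × M` containing `{0} × M`. -/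
structure LocalOneParamGroup {E : Type*} [NormedAddCommGroup E] [NormedSpace ℝ E]
    (M : Set E) where
  /-- the domain of the action -/
  dom : Set (ℝ × E)
  /-- the action (meaningful on `dom` only) -/
  act : ℝ → E → E
  isOpen_dom : IsOpen dom
  mem_of_dom : ∀ ε m, (ε, m) ∈ dom → m ∈ M
  zero_mem_dom : ∀ m ∈ M, ((0 : ℝ), m) ∈ dom
  act_mem : ∀ ε m, (ε, m) ∈ dom → act ε m ∈ M
  contDiffOn_act : ContDiffOn ℝ ∞ (fun y : ℝ × E => act y.1 y.2) dom
  act_act : ∀ ε δ m, (δ, m) ∈ dom → (ε, act δ m) ∈ dom → (ε + δ, m) ∈ dom →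
    act ε (act δ m) = act (ε + δ) m
  act_zero : ∀ m ∈ M, act 0 m = m
  neg_mem_dom : ∀ ε m, (ε, m) ∈ dom → (-ε, act ε m) ∈ dom

namespace LocalOneParamGroup

variable {E : Type*} [NormedAddCommGroup E] [NormedSpace ℝ E] {M : Set E}

/-- The domain of the transformation `act ε`. -/
def domAt (Φ : LocalOneParamGroup M) (ε : ℝ) : Set E := {m | (ε, m) ∈ Φ.dom}

/-- `v` is the infinitesimal generator of `Φ`, so that `Φ` is the flow of `v`. -/
def IsGeneratedBy (Φ : LocalOneParamGroup M) (v : E → E) : Prop :=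
  ∀ m ∈ M, HasDerivAt (fun ε => Φ.act ε m) (v m) 0

end LocalOneParamGroup

/-- `pr^(n) g · z = z'`, for a transformation `g` with domain `D ⊆ X × U`: there are a smooth
function `f` near `x₀`, with graph in `D` and `z = (x₀, pr^(n) f(x₀))`, and a smooth function
`f' = g · f` whose graph is the image under `g` of the graph of `f`, such that
`z' = (x₀', pr^(n) f'(x₀'))`, where `(x₀', u₀') = g · (x₀, u₀)`. -/
def ProlongedMapsTo {p q : ℕ} (n : ℕ) (g : BaseSpace p q → BaseSpace p q)
    (D : Set (BaseSpace p q)) (z z' : JetSpace p q n) : Prop :=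
  ∃ (Ω Ω' : Set (Fin p → ℝ)) (f f' : (Fin p → ℝ) → Fin q → ℝ),
    IsOpen Ω ∧ z.1 ∈ Ω ∧ ContDiffOn ℝ ∞ f Ω ∧ Ω.graphOn f ⊆ D ∧ jetAt n f z.1 = z ∧
    IsOpen Ω' ∧ ContDiffOn ℝ ∞ f' Ω' ∧ g '' Ω.graphOn f = Ω'.graphOn f' ∧
    z' = jetAt n f' (g z.base).1

/-- `V` is the `n`-th prolongation on `M^(n)` of the infinitesimal generator of `Φ`, i.e. the
infinitesimal generator of the prolonged group: for every `z ∈ M^(n)` the point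
`pr^(n) (Φ_ε) · z` is well defined for small `ε`, and its derivative at `ε = 0` is `V z`. -/
def IsProlongation {p q : ℕ} {M : Set (BaseSpace p q)} (Φ : LocalOneParamGroup M) (n : ℕ)
    (V : JetSpace p q n → JetSpace p q n) : Prop :=
  ∀ z ∈ JetSpace.jetsOver M n,
    (∀ᶠ ε in 𝓝 (0 : ℝ), ∃! z' : JetSpace p q n, ProlongedMapsTo n (Φ.act ε) (Φ.domAt ε) z z') ∧
    ∀ c : ℝ → JetSpace p q n,
      (∀ᶠ ε in 𝓝 (0 : ℝ), ProlongedMapsTo n (Φ.act ε) (Φ.domAt ε) z (c ε)) →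
      HasDerivAt c (V z) 0

/-! ### The coefficients in the prolongation formula -/

/-- The vector field `∑ ξ^i ∂/∂x^i + ∑ φ_α ∂/∂u^α` on `X × U`. -/
def vectorField {p q : ℕ} (ξ : Fin p → BaseSpace p q → ℝ) (φ : Fin q → BaseSpace p q → ℝ) :
    BaseSpace p q → BaseSpace p q :=
  fun m => (fun i => ξ i m, fun α => φ α m)

/-- `φ_α - ∑_i ξ^i u^α_i`, a function on the first jet space. -/
def characteristic {p q : ℕ} (ξ : Fin p → BaseSpace p q → ℝ) (φ : Fin q → BaseSpace p q → ℝ)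
    (α : Fin q) : JetSpace p q 1 → ℝ :=
  fun z => φ α z.base - ∑ i, ξ i z.base * z.2 α ⟨{i}, by simp⟩

/-- `D_J (φ_α - ∑_i ξ^i u^α_i) + ∑_i ξ^i u^α_{J,i}` for `J = (j₁, …, j_k)`, as a function on the
`(1+k)`-th jet space. -/
noncomputable def prolongationCoeff {p q : ℕ} (ξ : Fin p → BaseSpace p q → ℝ)
    (φ : Fin q → BaseSpace p q → ℝ) (α : Fin q) (L : List (Fin p)) :
    JetSpace p q (1 + L.length) → ℝ :=
  fun w => iterTotalDeriv L (characteristic ξ φ α) w +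
    ∑ i, ξ i w.base * w.2 α ⟨i ::ₘ (L : Multiset (Fin p)), by simp [add_comm]⟩

/-!
Move the graph of a function `f` by the flow and write `F(ε, ·)` for the function whose graph is
`Fl_ε (graph f)`. The map `(ε, x) ↦ (ε, (Fl_ε (x, f x)).1)` is invertible near `(0, x₀)` by the
inverse function theorem, so `F` is jointly smooth, and the prolonged flow sends the jet of `f` at
`x₀` to the jet of `F(ε, ·)` at the moving point `a ε = (Fl_ε (x₀, f x₀)).1`. That the result
depends only on the jet of `f` at `x₀` is the chain rule for equality of jets. Differentiating
`F(ε, a ε) = (Fl_ε (x₀, f x₀)).2` at `ε = 0` gives `∂_ε F = φ - ∑ ξ^i ∂_i f`, the characteristic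
`Q` evaluated on the jet of `f`. The same computation for `∂_J F(ε, a ε)`, with `∂_ε` and `∂_J`
interchanged, gives `∂_J (Q(jet f)) + ∑ ξ^i ∂_J ∂_i f`, and `∂_J (Q(jet f)) = (D_J Q)(jet f)`. As
every point of the jet space is the jet of a polynomial, this determines the coefficients
everywhere. The velocity of the prolonged flow at a point of the `n`-th jet space depends on that
point only, hence the coefficients do not depend on the coordinates of order `n + 1`.
-/

section EqJet

variable {𝕜 E F G : Type*} [NontriviallyNormedField 𝕜] [NormedAddCommGroup E] [NormedSpace 𝕜 E]
  [NormedAddCommGroup F] [NormedSpace 𝕜 F] [NormedAddCommGroup G] [NormedSpace 𝕜 G]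
  {n : ℕ} {x : E}

/-- `f` and `g` have the same `n`-jet at `x`: their derivatives of order `≤ n` at `x` agree. -/
def EqJet (𝕜 : Type*) {E F : Type*} [NontriviallyNormedField 𝕜] [NormedAddCommGroup E]
    [NormedSpace 𝕜 E] [NormedAddCommGroup F] [NormedSpace 𝕜 F] (n : ℕ) (f g : E → F) (x : E) :
    Prop :=
  ∀ k ≤ n, iteratedFDeriv 𝕜 k f x = iteratedFDeriv 𝕜 k g x

namespace EqJet

theorem of_eventuallyEq {f g : E → F} (h : f =ᶠ[𝓝 x] g) (n : ℕ) : EqJet 𝕜 n f g x :=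
  fun k _ => (h.iteratedFDeriv 𝕜 k).eq_of_nhds

theorem refl (n : ℕ) (f : E → F) (x : E) : EqJet 𝕜 n f f x := fun _ _ => rfl

theorem symm {f g : E → F} (h : EqJet 𝕜 n f g x) : EqJet 𝕜 n g f x :=
  fun k hk => (h k hk).symm

theorem trans {f g h : E → F} (hfg : EqJet 𝕜 n f g x) (hgh : EqJet 𝕜 n g h x) :
    EqJet 𝕜 n f h x :=
  fun k hk => (hfg k hk).trans (hgh k hk)

theorem apply_eq {f g : E → F} (h : EqJet 𝕜 n f g x) : f x = g x := by
  simpa using congrArg (fun T => T 0) (h 0 n.zero_le)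

theorem comp {g g' : F → G} {f f' : E → F} (hgg' : EqJet 𝕜 n g g' (f x))
    (hff' : EqJet 𝕜 n f f' x) (hg : ContDiffAt 𝕜 n g (f x)) (hg' : ContDiffAt 𝕜 n g' (f x))
    (hf : ContDiffAt 𝕜 n f x) (hf' : ContDiffAt 𝕜 n f' x) :
    EqJet 𝕜 n (g ∘ f) (g' ∘ f') x := by
  have hx : f x = f' x := hff'.apply_eq
  intro k hk
  have hk' : (k : WithTop ℕ∞) ≤ n := mod_cast hk
  rw [iteratedFDeriv_comp hg hf hk', iteratedFDeriv_comp (hx ▸ hg') hf' hk']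
  simp only [FormalMultilinearSeries.taylorComp]
  refine Finset.sum_congr rfl fun c _ => ?_
  ext v
  simp only [FormalMultilinearSeries.compAlongOrderedFinpartition_apply, ftaylorSeries,
    ← hx, hgg' _ (c.length_le.trans hk)]
  congr 1
  funext m
  simp only [OrderedFinpartition.applyOrderedFinpartition, hff' _ ((c.partSize_le m).trans hk)]

theorem prodMk {f f' : E → F} {g g' : E → G} (hff' : EqJet 𝕜 n f f' x)
    (hgg' : EqJet 𝕜 n g g' x) (hf : ContDiffAt 𝕜 n f x) (hf' : ContDiffAt 𝕜 n f' x)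
    (hg : ContDiffAt 𝕜 n g x) (hg' : ContDiffAt 𝕜 n g' x) :
    EqJet 𝕜 n (fun y => (f y, g y)) (fun y => (f' y, g' y)) x := by
  intro k hk
  have hk' : (k : WithTop ℕ∞) ≤ n := mod_cast hk
  rw [iteratedFDeriv_prodMk hf hg hk', iteratedFDeriv_prodMk hf' hg' hk', hff' k hk, hgg' k hk]

theorem of_comp {f g : F → G} {a : E → F} {r : F → E} {y : F}
    (h : EqJet 𝕜 n (f ∘ a) (g ∘ a) (r y)) (hr : ∀ᶠ z in 𝓝 y, a (r z) = z)
    (hf : ContDiffAt 𝕜 n f y) (hg : ContDiffAt 𝕜 n g y) (ha : ContDiffAt 𝕜 n a (r y))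
    (hr' : ContDiffAt 𝕜 n r y) : EqJet 𝕜 n f g y := by
  have har : a (r y) = y := hr.self_of_nhds
  have hcancel : ∀ k : F → G, (k ∘ a) ∘ r =ᶠ[𝓝 y] k := fun k =>
    hr.mono fun z hz => congrArg k hz
  have hcomp : EqJet 𝕜 n ((f ∘ a) ∘ r) ((g ∘ a) ∘ r) y :=
    h.comp (refl n r y) (.comp _ (by rwa [har]) ha) (.comp _ (by rwa [har]) ha) hr' hr'
  exact ((of_eventuallyEq (hcancel f) n).symm.trans hcomp).trans (of_eventuallyEq (hcancel g) n)

end EqJet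

theorem eqJet_pi {ι : Type*} [Fintype ι] {F' : ι → Type*} [∀ i, NormedAddCommGroup (F' i)]
    [∀ i, NormedSpace 𝕜 (F' i)] {f g : E → ∀ i, F' i} (hf : ContDiffAt 𝕜 n f x)
    (hg : ContDiffAt 𝕜 n g x) :
    EqJet 𝕜 n f g x ↔ ∀ i, EqJet 𝕜 n (fun y => f y i) (fun y => g y i) x := by
  have iteratedFDeriv_coord : ∀ {f : E → ∀ i, F' i}, ContDiffAt 𝕜 n f x → ∀ k ≤ n, ∀ i v,
      iteratedFDeriv 𝕜 k (fun y => f y i) x v = iteratedFDeriv 𝕜 k f x v i := fun hf k hk i v =>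
    congrArg (fun T => T v) <|
      (ContinuousLinearMap.proj (R := 𝕜) (φ := F') i).iteratedFDeriv_comp_left hf (i := k)
        (mod_cast hk)
  refine ⟨fun h i k hk => ?_, fun h k hk => ?_⟩
  · ext v
    rw [iteratedFDeriv_coord hf k hk, iteratedFDeriv_coord hg k hk, h k hk]
  · ext v i
    rw [← iteratedFDeriv_coord hf k hk, ← iteratedFDeriv_coord hg k hk, h i k hk]

end EqJet

section Coordinates

variable {p q n : ℕ} {Ω : Set (Fin p → ℝ)}

theorem iterPartialDeriv_congr (hΩ : IsOpen Ω) (L : List (Fin p)) {h k : (Fin p → ℝ) → ℝ}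
    (hhk : Set.EqOn h k Ω) : Set.EqOn (iterPartialDeriv L h) (iterPartialDeriv L k) Ω := by
  induction L with
  | nil => exact hhk
  | cons j L ih => exact partialDeriv_congr hΩ j ih

theorem iterPartialDeriv_toList (hΩ : IsOpen Ω) (L : List (Fin p)) {h : (Fin p → ℝ) → ℝ}
    (hh : ContDiffOn ℝ ∞ h Ω) :
    Set.EqOn (iterPartialDeriv (L : Multiset (Fin p)).toList h) (iterPartialDeriv L h) Ω :=
  iterPartialDeriv_perm hΩ (Multiset.coe_eq_coe.1 (Multiset.coe_toList _)) hh

theorem iterPartialDeriv_eq_iteratedFDeriv (hΩ : IsOpen Ω) {h : (Fin p → ℝ) → ℝ}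
    (hh : ContDiffOn ℝ ∞ h Ω) (L : List (Fin p)) :
    Set.EqOn (iterPartialDeriv L h)
      (fun x => iteratedFDeriv ℝ L.length h x fun l => Pi.single (L.get l) 1) Ω := by
  induction L with
  | nil => exact fun x _ => by simp [iterPartialDeriv]
  | cons j L ih =>
    intro x hx
    have hd : DifferentiableAt ℝ (iteratedFDeriv ℝ L.length h) x :=
      ((hh.contDiffAt (hΩ.mem_nhds hx)).iteratedFDeriv_right (m := 1)
        (mod_cast le_top)).differentiableAt (by simp)
    calc iterPartialDeriv (j :: L) h x
        = partialDeriv j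
            (fun y => iteratedFDeriv ℝ L.length h y fun l => Pi.single (L.get l) 1) x :=
          partialDeriv_congr hΩ j ih hx
      _ = fderiv ℝ (iteratedFDeriv ℝ L.length h) x (Pi.single j 1)
            fun l => Pi.single (L.get l) 1 := by
          rw [partialDeriv, (hd.hasFDerivAt.continuousMultilinear_apply_const _).fderiv]
          rfl

theorem eqJet_of_forall_iterPartialDeriv_eq (hΩ : IsOpen Ω) {f g : (Fin p → ℝ) → ℝ}
    (hf : ContDiffOn ℝ ∞ f Ω) (hg : ContDiffOn ℝ ∞ g Ω) {x : Fin p → ℝ} (hx : x ∈ Ω)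
    (h : ∀ L : List (Fin p), L.length ≤ n → iterPartialDeriv L f x = iterPartialDeriv L g x) :
    EqJet ℝ n f g x := by
  intro k hk
  apply ContinuousMultilinearMap.toMultilinearMap_injective
  refine Module.Basis.ext_multilinear (fun _ => Pi.basisFun ℝ (Fin p)) fun v => ?_
  obtain ⟨L, rfl, rfl⟩ : ∃ (L : List (Fin p)) (hL : L.length = k), v = L.get ∘ Fin.cast hL.symm :=
    ⟨List.ofFn v, List.length_ofFn, by ext l; simp⟩
  have hL := h L hk
  rw [iterPartialDeriv_eq_iteratedFDeriv hΩ hf L hx,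
    iterPartialDeriv_eq_iteratedFDeriv hΩ hg L hx] at hL
  simpa [Pi.basisFun_apply] using hL

theorem jetAt_base (n : ℕ) (f : (Fin p → ℝ) → Fin q → ℝ) (x : Fin p → ℝ) :
    (jetAt n f x).base = (x, f x) := by
  simp [jetAt, JetSpace.base, iterPartialDeriv]

theorem jetAt_snd_coe (hΩ : IsOpen Ω) {f : (Fin p → ℝ) → Fin q → ℝ} (hf : ContDiffOn ℝ ∞ f Ω)
    {x : Fin p → ℝ} (hx : x ∈ Ω) (α : Fin q) {L : List (Fin p)} (hL : L.length ≤ n) :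
    (jetAt n f x).2 α ⟨(L : Multiset (Fin p)), hL⟩ = iterPartialDeriv L (fun y => f y α) x :=
  iterPartialDeriv_toList hΩ L (contDiffOn_pi.1 hf α) hx

theorem jetAt_eq_iff_eqJet (hΩ : IsOpen Ω) {f g : (Fin p → ℝ) → Fin q → ℝ}
    (hf : ContDiffOn ℝ ∞ f Ω) (hg : ContDiffOn ℝ ∞ g Ω) {x : Fin p → ℝ} (hx : x ∈ Ω) :
    jetAt n f x = jetAt n g x ↔ EqJet ℝ n f g x := by
  have hfα := contDiffOn_pi.1 hf
  have hgα := contDiffOn_pi.1 hg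
  have hn : (n : WithTop ℕ∞) ≤ ∞ := mod_cast le_top
  rw [eqJet_pi ((hf.contDiffAt (hΩ.mem_nhds hx)).of_le hn)
    ((hg.contDiffAt (hΩ.mem_nhds hx)).of_le hn)]
  refine ⟨fun h α => ?_, fun h => Prod.ext rfl (funext₂ fun α J => ?_)⟩
  · refine eqJet_of_forall_iterPartialDeriv_eq hΩ (hfα α) (hgα α) hx fun L hL => ?_
    rw [← jetAt_snd_coe hΩ hf hx α hL, ← jetAt_snd_coe hΩ hg hx α hL, h]
  · simp only [jetAt, iterPartialDeriv_eq_iteratedFDeriv hΩ (hfα α) _ hx,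
      iterPartialDeriv_eq_iteratedFDeriv hΩ (hgα α) _ hx]
    rw [h α _ (by simpa using J.2)]

end Coordinates

section TransformedGraph

theorem fst_mem_and_apply_fst_eq_of_image_graphOn {α β γ δ : Type*} {g : α × β → γ × δ}
    {f : α → β} {f' : γ → δ} {s : Set α} {t : Set γ} (h : g '' s.graphOn f = t.graphOn f') {x : α}
    (hx : x ∈ s) : (g (x, f x)).1 ∈ t ∧ f' (g (x, f x)).1 = (g (x, f x)).2 := by
  have hmem : g (x, f x) ∈ t.graphOn f' := h ▸ Set.mem_image_of_mem g (Set.mem_graphOn.2 ⟨hx, rfl⟩)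
  exact Set.mem_graphOn.1 hmem

theorem exists_apply_eq_of_image_graphOn {α β γ δ : Type*} {g : α × β → γ × δ} {f : α → β}
    {f' : γ → δ} {s : Set α} {t : Set γ} (h : g '' s.graphOn f = t.graphOn f') {y : γ}
    (hy : y ∈ t) : ∃ x ∈ s, g (x, f x) = (y, f' y) := by
  obtain ⟨_, ⟨x, hx, rfl⟩, hgx⟩ := h.symm ▸ (Set.mem_graphOn.2 ⟨hy, rfl⟩ : (y, f' y) ∈ t.graphOn f')
  exact ⟨x, hx, hgx⟩

variable {𝕜 E F E' F' : Type*} [NontriviallyNormedField 𝕜] [NormedAddCommGroup E]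
  [NormedSpace 𝕜 E] [NormedAddCommGroup F] [NormedSpace 𝕜 F] [NormedAddCommGroup E']
  [NormedSpace 𝕜 E'] [NormedAddCommGroup F'] [NormedSpace 𝕜 F'] {n : ℕ} {g : E × F → E' × F'}
  {f k : E → F} {f' k' : E' → F'}

theorem EqJet.of_eventually_apply_fst_eq {r : E' → E} {x : E} {y : E'} (hrx : r y = x)
    (hfk : EqJet 𝕜 n f k x) (hg : ContDiffAt 𝕜 n g (x, f x))
    (hf : ContDiffAt 𝕜 n f x) (hk : ContDiffAt 𝕜 n k x)
    (hf' : ContDiffAt 𝕜 n f' y) (hk' : ContDiffAt 𝕜 n k' y) (hr : ContDiffAt 𝕜 n r y)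
    (hgf : ∀ᶠ w in 𝓝 x, f' (g (w, f w)).1 = (g (w, f w)).2)
    (hgk : ∀ᶠ w in 𝓝 x, k' (g (w, k w)).1 = (g (w, k w)).2)
    (hinv : ∀ᶠ z in 𝓝 y, (g (r z, f (r z))).1 = z) : EqJet 𝕜 n f' k' y := by
  subst hrx
  have hy : (g (r y, f (r y))).1 = y := hinv.self_of_nhds
  have hgraph_f : ContDiffAt 𝕜 n (fun w => (w, f w)) (r y) := contDiffAt_id.prodMk hf
  have hgraph_k : ContDiffAt 𝕜 n (fun w => (w, k w)) (r y) := contDiffAt_id.prodMk hk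
  have hGf : ContDiffAt 𝕜 n (g ∘ fun w => (w, f w)) (r y) := .comp (r y) hg hgraph_f
  have hGk : ContDiffAt 𝕜 n (g ∘ fun w => (w, k w)) (r y) :=
    .comp (r y) (hfk.apply_eq ▸ hg) hgraph_k
  have hG : EqJet 𝕜 n (g ∘ fun w => (w, f w)) (g ∘ fun w => (w, k w)) (r y) :=
    (refl n g _).comp ((refl n id _).prodMk hfk contDiffAt_id contDiffAt_id hf hk) hg hg
      hgraph_f hgraph_k
  have hfst : EqJet 𝕜 n (fun w => (g (w, f w)).1) (fun w => (g (w, k w)).1) (r y) :=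
    (refl n Prod.fst _).comp hG contDiffAt_fst contDiffAt_fst hGf hGk
  have hsnd : EqJet 𝕜 n (fun w => (g (w, f w)).2) (fun w => (g (w, k w)).2) (r y) :=
    (refl n Prod.snd _).comp hG contDiffAt_snd contDiffAt_snd hGf hGk
  have hk'a : EqJet 𝕜 n (k' ∘ fun w => (g (w, f w)).1) (k' ∘ fun w => (g (w, k w)).1) (r y) :=
    (refl n k' _).comp hfst (by rwa [hy]) (by rwa [hy]) hGf.fst hGk.fst
  have ha : EqJet 𝕜 n (f' ∘ fun w => (g (w, f w)).1) (k' ∘ fun w => (g (w, f w)).1) (r y) :=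
    ((of_eventuallyEq hgf n).trans hsnd).trans ((of_eventuallyEq hgk n).symm.trans hk'a.symm)
  exact ha.of_comp hinv hf' hk' hGf.fst hr

/-- The base coordinate `a w = (g (w, f w)).1` of the image of the graph of `f` has the right
inverse `y ↦ (g' (y, f' y)).1`, which is smooth because `g'` and `f'` are. -/
theorem EqJet.of_image_graphOn {g' : E' × F' → E × F} {s s' : Set E} {t t' : Set E'} {x : E}
    (hs : s ∈ 𝓝 x) (hs' : s' ∈ 𝓝 x) (ht : t ∈ 𝓝 (g (x, f x)).1)
    (hgf : g '' s.graphOn f = t.graphOn f') (hgk : g '' s'.graphOn k = t'.graphOn k')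
    (hinv : ∀ w ∈ s, g' (g (w, f w)) = (w, f w)) (hfk : EqJet 𝕜 n f k x)
    (hg : ContDiffAt 𝕜 n g (x, f x)) (hg' : ContDiffAt 𝕜 n g' (g (x, f x)))
    (hf : ContDiffAt 𝕜 n f x) (hk : ContDiffAt 𝕜 n k x)
    (hf' : ContDiffAt 𝕜 n f' (g (x, f x)).1) (hk' : ContDiffAt 𝕜 n k' (g (x, f x)).1) :
    EqJet 𝕜 n f' k' (g (x, f x)).1 := by
  have hx : g (x, f x) = ((g (x, f x)).1, f' (g (x, f x)).1) :=
    Prod.ext rfl (fst_mem_and_apply_fst_eq_of_image_graphOn hgf (mem_of_mem_nhds hs)).2.symm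
  have hr : ContDiffAt 𝕜 n (fun y => (g' (y, f' y)).1) (g (x, f x)).1 :=
    (ContDiffAt.comp _ (hx ▸ hg') (contDiffAt_id.prodMk hf')).fst
  refine of_eventually_apply_fst_eq ?_ hfk hg hf hk hf' hk' hr
    (Filter.mem_of_superset hs fun w hw => (fst_mem_and_apply_fst_eq_of_image_graphOn hgf hw).2)
    (Filter.mem_of_superset hs' fun w hw => (fst_mem_and_apply_fst_eq_of_image_graphOn hgk hw).2)
    (Filter.mem_of_superset ht fun y hy => ?_)
  · simp only [← hx, hinv x (mem_of_mem_nhds hs)]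
  · obtain ⟨w, hw, hgw⟩ := exists_apply_eq_of_image_graphOn hgf hy
    simp only [Set.mem_ofPred_eq, ← hgw, hinv w hw]
    rw [hgw]

end TransformedGraph

theorem ProlongedMapsTo.unique {p q n : ℕ} {g g' : BaseSpace p q → BaseSpace p q}
    {D : Set (BaseSpace p q)} {z z₁ z₂ : JetSpace p q n} (hg : ContDiffAt ℝ ∞ g z.base)
    (hg' : ContDiffAt ℝ ∞ g' (g z.base)) (hinv : ∀ m ∈ D, g' (g m) = m)
    (h₁ : ProlongedMapsTo n g D z z₁) (h₂ : ProlongedMapsTo n g D z z₂) : z₁ = z₂ := by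
  obtain ⟨Ω, Ω', f, f', hΩ, hx, hf, hfD, hfz, hΩ', hf', hgf, rfl⟩ := h₁
  obtain ⟨Θ, Θ', k, k', hΘ, hx', hk, -, hkz, hΘ', hk', hgk, rfl⟩ := h₂
  have hn : (n : WithTop ℕ∞) ≤ ∞ := mod_cast le_top
  have hfk : EqJet ℝ n f k z.1 :=
    (jetAt_eq_iff_eqJet (hΩ.inter hΘ) (hf.mono Set.inter_subset_left)
      (hk.mono Set.inter_subset_right) ⟨hx, hx'⟩).1 (hfz.trans hkz.symm)
  have hbase : z.base = (z.1, f z.1) := by rw [← jetAt_base n f, hfz]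
  rw [hbase] at hg hg' ⊢
  have hy : (g (z.1, f z.1)).1 ∈ Ω' := (fst_mem_and_apply_fst_eq_of_image_graphOn hgf hx).1
  have hy' : (g (z.1, f z.1)).1 ∈ Θ' :=
    hfk.apply_eq ▸ (fst_mem_and_apply_fst_eq_of_image_graphOn hgk hx').1
  refine (jetAt_eq_iff_eqJet (hΩ'.inter hΘ') (hf'.mono Set.inter_subset_left)
    (hk'.mono Set.inter_subset_right) ⟨hy, hy'⟩).2 ?_
  exact EqJet.of_image_graphOn (hΩ.mem_nhds hx) (hΘ.mem_nhds hx') (hΩ'.mem_nhds hy) hgf hgk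
    (fun w hw => hinv _ (hfD ⟨w, hw, rfl⟩)) hfk (hg.of_le hn) (hg'.of_le hn)
    ((hf.contDiffAt (hΩ.mem_nhds hx)).of_le hn) ((hk.contDiffAt (hΘ.mem_nhds hx')).of_le hn)
    ((hf'.contDiffAt (hΩ'.mem_nhds hy)).of_le hn) ((hk'.contDiffAt (hΘ'.mem_nhds hy')).of_le hn)

section InverseFunction

variable {𝕂 E F P : Type*} [RCLike 𝕂] [NormedAddCommGroup E] [NormedSpace 𝕂 E]
  [NormedAddCommGroup F] [NormedSpace 𝕂 F] [NormedAddCommGroup P] [NormedSpace 𝕂 P]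
  [CompleteSpace E] {n : WithTop ℕ∞}

theorem exists_openPartialHomeomorph_contDiffOn_symm (hn : n ≠ 0) {f : E → F} {s : Set E}
    (hs : IsOpen s) (hf : ContDiffOn 𝕂 n f s) {a : E} (ha : a ∈ s) {f' : E ≃L[𝕂] F}
    (hf' : HasFDerivAt f (f' : E →L[𝕂] F) a) :
    ∃ e : OpenPartialHomeomorph E F, ⇑e = f ∧ a ∈ e.source ∧ e.source ⊆ s ∧
      ContDiffOn 𝕂 n e.symm e.target := by
  have hfa : ContDiffAt 𝕂 n f a := hf.contDiffAt (hs.mem_nhds ha)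
  set t : Set E := s ∩ fderiv 𝕂 f ⁻¹' Set.range ((↑) : (E ≃L[𝕂] F) → E →L[𝕂] F)
  have hfderiv : ContinuousOn (fderiv 𝕂 f) s :=
    hf.continuousOn_fderiv_of_isOpen hs (ENat.one_le_iff_ne_zero_withTop.2 hn)
  have ht : IsOpen t := hfderiv.isOpen_inter_preimage hs ContinuousLinearEquiv.isOpen
  let e := (hfa.toOpenPartialHomeomorph f hf' hn).restrOpen t ht
  refine ⟨e, rfl, ⟨hfa.mem_toOpenPartialHomeomorph_source hf' hn, ha, f', hf'.fderiv.symm⟩,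
    fun x hx => hx.2.1, fun y hy => ?_⟩
  obtain ⟨-, hxs, A, hA⟩ := e.map_target hy
  have hfx : ContDiffAt 𝕂 n f (e.symm y) := hf.contDiffAt (hs.mem_nhds hxs)
  refine (e.contDiffAt_symm (f₀' := A) hy ?_ hfx).contDiffWithinAt
  exact hA ▸ (hfx.differentiableAt hn).hasFDerivAt

theorem exists_openPartialHomeomorph_prodMk [CompleteSpace P] (hn : n ≠ 0) {a : P × E → F}
    {s : Set (P × E)} (hs : IsOpen s) (ha : ContDiffOn 𝕂 n a s) {t₀ : P} {x₀ : E}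
    (h₀ : (t₀, x₀) ∈ s) {a' : E ≃L[𝕂] F}
    (ha' : HasFDerivAt (fun x => a (t₀, x)) (a' : E →L[𝕂] F) x₀) :
    ∃ e : OpenPartialHomeomorph (P × E) (P × F), (⇑e = fun y => (y.1, a y)) ∧
      (t₀, x₀) ∈ e.source ∧ e.source ⊆ s ∧ ContDiffOn 𝕂 n e.symm e.target := by
  set D := fderiv 𝕂 a (t₀, x₀)
  have hD : HasFDerivAt a D (t₀, x₀) :=
    ((ha.contDiffAt (hs.mem_nhds h₀)).differentiableAt hn).hasFDerivAt
  have hDa' : ∀ y, D (0, y) = a' y :=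
    DFunLike.congr_fun ((hD.comp x₀ (hasFDerivAt_prodMk_right t₀ x₀)).unique ha')
  refine exists_openPartialHomeomorph_contDiffOn_symm hn hs (contDiffOn_fst.prodMk ha) h₀
    (f' := (ContinuousLinearEquiv.refl 𝕂 P).skewProd a' (D.comp (.inl 𝕂 P E))) ?_
  convert! hasFDerivAt_fst.prodMk hD using 1
  ext y <;> simp [hDa']

end InverseFunction

section PrescribedJet

variable {p q : ℕ}

theorem hasDerivAt_sub_pow_succ_div_factorial (a t : ℝ) (m : ℕ) :
    HasDerivAt (fun s : ℝ => (s - a) ^ (m + 1) / (m + 1).factorial) ((t - a) ^ m / m.factorial)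
      t := by
  convert! (((hasDerivAt_id t).sub_const a).pow (m + 1)).div_const ((m + 1).factorial : ℝ) using 1
  rw [Nat.factorial_succ]
  push_cast
  field_simp
  simp

theorem partialDeriv_prod_apply {g : Fin p → ℝ → ℝ} {x : Fin p → ℝ}
    (hg : ∀ i, DifferentiableAt ℝ (g i) (x i)) (j : Fin p) :
    partialDeriv j (fun y => ∏ i, g i (y i)) x =
      (∏ i ∈ Finset.univ.erase j, g i (x i)) * deriv (g j) (x j) := by
  have hcoord : ∀ i ∈ Finset.univ, HasFDerivAt (fun y : Fin p → ℝ => g i (y i))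
      (deriv (g i) (x i) • ContinuousLinearMap.proj i : (Fin p → ℝ) →L[ℝ] ℝ) x := fun i _ =>
    (hg i).hasDerivAt.comp_hasFDerivAt x (hasFDerivAt_apply i x)
  rw [partialDeriv, (HasFDerivAt.finsetProd hcoord).fderiv]
  simp [Pi.single_apply]

/-- The Taylor monomial `(x - a)^J / J!`, dual to the derivatives `∂_J` at `a`. -/
noncomputable def taylorMonomial (a : Fin p → ℝ) (J : Multiset (Fin p)) (x : Fin p → ℝ) : ℝ :=
  ∏ i, (x i - a i) ^ J.count i / (J.count i).factorial

theorem contDiff_taylorMonomial (a : Fin p → ℝ) (J : Multiset (Fin p)) :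
    ContDiff ℝ ∞ (taylorMonomial a J) := by
  unfold taylorMonomial
  fun_prop

theorem taylorMonomial_self (a : Fin p → ℝ) (J : Multiset (Fin p)) :
    taylorMonomial a J a = if J = 0 then 1 else 0 := by
  split_ifs with hJ
  · simp [taylorMonomial, hJ]
  · obtain ⟨i, hi⟩ := Multiset.exists_mem_of_ne_zero hJ
    exact Finset.prod_eq_zero (Finset.mem_univ i) (by simp [Multiset.count_eq_zero, hi])

theorem partialDeriv_taylorMonomial (a : Fin p → ℝ) (J : Multiset (Fin p)) (j : Fin p)
    (x : Fin p → ℝ) :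
    partialDeriv j (taylorMonomial a J) x =
      (∏ i ∈ Finset.univ.erase j, (x i - a i) ^ J.count i / (J.count i).factorial) *
        deriv (fun t => (t - a j) ^ J.count j / (J.count j).factorial) (x j) :=
  partialDeriv_prod_apply (g := fun i t => (t - a i) ^ J.count i / (J.count i).factorial)
    (fun i => by fun_prop) j

theorem partialDeriv_taylorMonomial_cons (a : Fin p → ℝ) (J : Multiset (Fin p)) (j : Fin p) :
    partialDeriv j (taylorMonomial a (j ::ₘ J)) = taylorMonomial a J := by
  funext x
  rw [partialDeriv_taylorMonomial, taylorMonomial, ← Finset.prod_erase_mul _ _ (Finset.mem_univ j),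
    Multiset.count_cons_self, (hasDerivAt_sub_pow_succ_div_factorial _ _ _).deriv]
  congr 1
  refine Finset.prod_congr rfl fun i hi => ?_
  rw [Multiset.count_cons_of_ne (Finset.ne_of_mem_erase hi)]

theorem partialDeriv_taylorMonomial_of_notMem (a : Fin p → ℝ) {J : Multiset (Fin p)} {j : Fin p}
    (hj : j ∉ J) : partialDeriv j (taylorMonomial a J) = 0 := by
  funext x
  simp [partialDeriv_taylorMonomial, Multiset.count_eq_zero_of_notMem hj]

theorem iterPartialDeriv_zero (L : List (Fin p)) :
    iterPartialDeriv L (0 : (Fin p → ℝ) → ℝ) = 0 := by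
  induction L with
  | nil => rfl
  | cons j L ih =>
    change partialDeriv j (iterPartialDeriv L 0) = 0
    funext x
    simp [ih, partialDeriv]

theorem iterPartialDeriv_taylorMonomial_self (a : Fin p → ℝ) (L : List (Fin p))
    (J : Multiset (Fin p)) :
    iterPartialDeriv L (taylorMonomial a J) a = if (L : Multiset (Fin p)) = J then 1 else 0 := by
  induction L using List.reverseRecOn generalizing J with
  | nil => simpa [iterPartialDeriv, eq_comm] using taylorMonomial_self a J
  | append_singleton L j ih =>
    have hL : ((L ++ [j] : List (Fin p)) : Multiset (Fin p)) = j ::ₘ (L : Multiset (Fin p)) :=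
      Multiset.coe_eq_coe.2 (List.perm_append_singleton j L)
    have hstep : iterPartialDeriv (L ++ [j]) (taylorMonomial a J) =
        iterPartialDeriv L (partialDeriv j (taylorMonomial a J)) := List.foldr_append
    rw [hstep, hL]
    by_cases hj : j ∈ J
    · obtain ⟨K, rfl⟩ := Multiset.exists_cons_of_mem hj
      simp only [partialDeriv_taylorMonomial_cons, ih, Multiset.cons_inj_right]
    · rw [partialDeriv_taylorMonomial_of_notMem a hj, iterPartialDeriv_zero, if_neg]
      · rfl
      · exact fun h => hj (h ▸ Multiset.mem_cons_self j _)

theorem iterPartialDeriv_sum_mul {ι : Type*} {Ω : Set (Fin p → ℝ)} (hΩ : IsOpen Ω) (s : Finset ι)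
    (c : ι → ℝ) {h : ι → (Fin p → ℝ) → ℝ} (hh : ∀ i ∈ s, ContDiffOn ℝ ∞ (h i) Ω)
    (L : List (Fin p)) :
    Set.EqOn (iterPartialDeriv L (fun x => ∑ i ∈ s, c i * h i x))
      (fun x => ∑ i ∈ s, c i * iterPartialDeriv L (h i) x) Ω := by
  induction L with
  | nil => exact fun _ _ => rfl
  | cons j L ih =>
    refine (partialDeriv_congr hΩ j ih).trans fun x hx => ?_
    have hd : ∀ i ∈ s, DifferentiableAt ℝ (iterPartialDeriv L (h i)) x := fun i hi =>
      ((iterPartialDeriv_contDiffOn hΩ L (hh i hi)).contDiffAt (hΩ.mem_nhds hx)).differentiableAt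
        (by simp)
    rw [partialDeriv,
      (HasFDerivAt.fun_sum fun i hi => (hd i hi).hasFDerivAt.const_mul (c i)).fderiv]
    simp [iterPartialDeriv, partialDeriv]

theorem exists_contDiff_jetAt_eq {n : ℕ} (w : JetSpace p q n) :
    ∃ f : (Fin p → ℝ) → Fin q → ℝ, ContDiff ℝ ∞ f ∧ jetAt n f w.1 = w := by
  refine ⟨fun x α => ∑ J : MultiIndex p n, w.2 α J * taylorMonomial w.1 J.1 x,
    contDiff_pi.2 fun α => ContDiff.sum fun J _ => contDiff_const.mul (contDiff_taylorMonomial _ _),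
    Prod.ext rfl (funext₂ fun α K => ?_)⟩
  calc iterPartialDeriv K.1.toList
        (fun x => ∑ J : MultiIndex p n, w.2 α J * taylorMonomial w.1 J.1 x) w.1
      = ∑ J : MultiIndex p n, w.2 α J * iterPartialDeriv K.1.toList (taylorMonomial w.1 J.1) w.1 :=
        iterPartialDeriv_sum_mul isOpen_univ _ _
          (fun J _ => (contDiff_taylorMonomial _ _).contDiffOn) _ (Set.mem_univ _)
    _ = w.2 α K := by
        simp [iterPartialDeriv_taylorMonomial_self, Subtype.val_inj]

end PrescribedJet

section Smoothness

variable {p q n : ℕ} {M : Set (BaseSpace p q)} {ξ : Fin p → BaseSpace p q → ℝ}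
  {φ : Fin q → BaseSpace p q → ℝ} {Ω : Set (Fin p → ℝ)} {f : (Fin p → ℝ) → Fin q → ℝ}

theorem JetSpace.contDiff_proj {k : ℕ} (h : k ≤ n) :
    ContDiff ℝ ∞ (proj h : JetSpace p q n → JetSpace p q k) := by
  unfold proj
  fun_prop

theorem JetSpace.contDiff_base : ContDiff ℝ ∞ (base : JetSpace p q n → BaseSpace p q) := by
  unfold base
  fun_prop

theorem JetSpace.isOpen_jetsOver (hM : IsOpen M) (n : ℕ) : IsOpen (jetsOver M n) :=
  hM.preimage contDiff_base.continuous

theorem jetAt_mem_jetsOver {x : Fin p → ℝ} :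
    jetAt n f x ∈ JetSpace.jetsOver M n ↔ (x, f x) ∈ M := by
  rw [JetSpace.jetsOver, Set.mem_ofPred_eq, jetAt_base]

theorem jetAt_contDiffOn (hΩ : IsOpen Ω) (hf : ContDiffOn ℝ ∞ f Ω) (n : ℕ) :
    ContDiffOn ℝ ∞ (jetAt n f) Ω :=
  contDiffOn_id.prodMk <| contDiffOn_pi.2 fun α => contDiffOn_pi.2 fun J =>
    iterPartialDeriv_contDiffOn hΩ J.1.toList (contDiffOn_pi.1 hf α)

theorem totalDeriv_contDiffOn (hM : IsOpen M) (i : Fin p) {P : JetSpace p q n → ℝ}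
    (hP : ContDiffOn ℝ ∞ P (JetSpace.jetsOver M n)) :
    ContDiffOn ℝ ∞ (totalDeriv i P) (JetSpace.jetsOver M (n + 1)) := by
  have hP' : ContDiffOn ℝ ∞ (fun w : JetSpace p q (n + 1) => fderiv ℝ P (w.proj n.le_succ))
      (JetSpace.jetsOver M (n + 1)) :=
    (hP.fderiv_of_isOpen (JetSpace.isOpen_jetsOver hM n) (m := ∞) (by simp)).comp
      (JetSpace.contDiff_proj n.le_succ).contDiffOn fun _ hw => hw
  exact (hP'.clm_apply contDiffOn_const).add <| ContDiffOn.sum fun α _ => ContDiffOn.sum fun J _ =>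
    ContDiffOn.mul (ContDiff.contDiffOn (by fun_prop)) (hP'.clm_apply contDiffOn_const)

theorem iterTotalDeriv_contDiffOn (hM : IsOpen M) {P : JetSpace p q n → ℝ}
    (hP : ContDiffOn ℝ ∞ P (JetSpace.jetsOver M n)) (L : List (Fin p)) :
    ContDiffOn ℝ ∞ (iterTotalDeriv L P) (JetSpace.jetsOver M (n + L.length)) := by
  induction L with
  | nil => exact hP
  | cons j L ih => exact totalDeriv_contDiffOn hM j ih

theorem characteristic_contDiffOn (hv : ContDiffOn ℝ ∞ (vectorField ξ φ) M) (α : Fin q) :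
    ContDiffOn ℝ ∞ (characteristic ξ φ α) (JetSpace.jetsOver M 1) := by
  have hv' := hv.comp (JetSpace.contDiff_base (n := 1)).contDiffOn fun _ hw => hw
  exact (contDiffOn_pi.1 hv'.snd α).sub <| ContDiffOn.sum fun i _ =>
    (contDiffOn_pi.1 hv'.fst i).mul (ContDiff.contDiffOn (by fun_prop))

theorem prolongationCoeff_contDiffOn (hM : IsOpen M) (hv : ContDiffOn ℝ ∞ (vectorField ξ φ) M)
    (α : Fin q) (L : List (Fin p)) :
    ContDiffOn ℝ ∞ (prolongationCoeff ξ φ α L) (JetSpace.jetsOver M (1 + L.length)) := by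
  have hv' := hv.comp (JetSpace.contDiff_base (n := 1 + L.length)).contDiffOn fun _ hw => hw
  exact (iterTotalDeriv_contDiffOn hM (characteristic_contDiffOn hv α) L).add <|
    ContDiffOn.sum fun i _ => (contDiffOn_pi.1 hv'.fst i).mul (ContDiff.contDiffOn (by fun_prop))

end Smoothness

section Coefficients

variable {p q n : ℕ} {M : Set (BaseSpace p q)} {ξ : Fin p → BaseSpace p q → ℝ}
  {φ : Fin q → BaseSpace p q → ℝ} {Ω : Set (Fin p → ℝ)} {f : (Fin p → ℝ) → Fin q → ℝ}

theorem iterTotalDeriv_jetAt (hM : IsOpen M) {P : JetSpace p q n → ℝ}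
    (hP : ContDiffOn ℝ ∞ P (JetSpace.jetsOver M n)) (hΩ : IsOpen Ω) (hf : ContDiffOn ℝ ∞ f Ω)
    (hfM : ∀ x ∈ Ω, (x, f x) ∈ M) (L : List (Fin p)) :
    Set.EqOn (fun x => iterTotalDeriv L P (jetAt (n + L.length) f x))
      (iterPartialDeriv L fun x => P (jetAt n f x)) Ω := by
  induction L with
  | nil => exact fun _ _ => rfl
  | cons j L ih =>
    intro x hx
    have hd : DifferentiableAt ℝ (iterTotalDeriv L P) (jetAt (n + L.length) f x) :=
      ((iterTotalDeriv_contDiffOn hM hP L).contDiffAt ((JetSpace.isOpen_jetsOver hM _).mem_nhds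
        (jetAt_mem_jetsOver.2 (hfM x hx)))).differentiableAt (by simp)
    exact (totalDeriv_jetAt hΩ hf hx j hd).trans (partialDeriv_congr hΩ j ih hx)

theorem characteristic_jetAt (α : Fin q) (x : Fin p → ℝ) :
    characteristic ξ φ α (jetAt 1 f x) =
      φ α (x, f x) - ∑ i, ξ i (x, f x) * partialDeriv i (fun y => f y α) x := by
  rw [characteristic, jetAt_base]
  simp [jetAt, iterPartialDeriv]

theorem characteristic_jetAt_contDiffOn (hv : ContDiffOn ℝ ∞ (vectorField ξ φ) M)
    (hΩ : IsOpen Ω) (hf : ContDiffOn ℝ ∞ f Ω) (hfM : ∀ x ∈ Ω, (x, f x) ∈ M) (α : Fin q) :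
    ContDiffOn ℝ ∞ (fun x => characteristic ξ φ α (jetAt 1 f x)) Ω :=
  (characteristic_contDiffOn hv α).comp (jetAt_contDiffOn hΩ hf 1) fun x hx =>
    jetAt_mem_jetsOver.2 (hfM x hx)

theorem prolongationCoeff_jetAt (hM : IsOpen M) (hv : ContDiffOn ℝ ∞ (vectorField ξ φ) M)
    (hΩ : IsOpen Ω) (hf : ContDiffOn ℝ ∞ f Ω) (hfM : ∀ x ∈ Ω, (x, f x) ∈ M) (α : Fin q)
    (L : List (Fin p)) {x : Fin p → ℝ} (hx : x ∈ Ω) :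
    prolongationCoeff ξ φ α L (jetAt (1 + L.length) f x) =
      iterPartialDeriv L (fun y => characteristic ξ φ α (jetAt 1 f y)) x +
        ∑ i, ξ i (x, f x) * iterPartialDeriv (i :: L) (fun y => f y α) x := by
  have hjet : ∀ i, (jetAt (1 + L.length) f x).2 α
      ⟨i ::ₘ (L : Multiset (Fin p)), by simp [add_comm]⟩ =
        iterPartialDeriv (i :: L) (fun y => f y α) x := fun i =>
    jetAt_snd_coe hΩ hf hx α (L := i :: L) (by simp [add_comm])
  rw [prolongationCoeff, jetAt_base]
  simp only [hjet]
  exact congrArg (· + _)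
    (iterTotalDeriv_jetAt hM (characteristic_contDiffOn hv α) hΩ hf hfM L hx)

theorem prolongationCoeff_perm (hM : IsOpen M) (hv : ContDiffOn ℝ ∞ (vectorField ξ φ) M)
    (α : Fin q) {L L' : List (Fin p)} (hLL' : L.Perm L') {w : JetSpace p q n}
    (hw : w ∈ JetSpace.jetsOver M n) (hL : 1 + L.length ≤ n) (hL' : 1 + L'.length ≤ n) :
    prolongationCoeff ξ φ α L (w.proj hL) = prolongationCoeff ξ φ α L' (w.proj hL') := by
  obtain ⟨f, hf, hfw⟩ := exists_contDiff_jetAt_eq w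
  generalize w.1 = x at hfw
  subst hfw
  set Ω : Set (Fin p → ℝ) := {y | (y, f y) ∈ M}
  have hΩ : IsOpen Ω := hM.preimage (continuous_id.prodMk hf.continuous)
  have hx : x ∈ Ω := jetAt_mem_jetsOver.1 hw
  refine (prolongationCoeff_jetAt hM hv hΩ hf.contDiffOn (fun _ => id) α L hx).trans
    (Eq.trans ?_ (prolongationCoeff_jetAt hM hv hΩ hf.contDiffOn (fun _ => id) α L' hx).symm)
  congr 1
  · exact iterPartialDeriv_perm hΩ hLL'
      (characteristic_jetAt_contDiffOn hv hΩ hf.contDiffOn (fun _ => id) α) hx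
  · refine Finset.sum_congr rfl fun i _ => congrArg _ ?_
    exact iterPartialDeriv_perm hΩ (hLL'.cons i) (contDiffOn_pi.1 hf.contDiffOn α) hx

theorem prolongationCoeff_nil (α : Fin q) (w : JetSpace p q 1) :
    prolongationCoeff ξ φ α [] w = φ α w.base :=
  sub_add_cancel _ _

end Coefficients

theorem fderiv_fderiv_apply_comm {𝕜 E F : Type*} [NontriviallyNormedField 𝕜]
    [NormedAddCommGroup E] [NormedSpace 𝕜 E] [NormedAddCommGroup F] [NormedSpace 𝕜 F] {f : E → F}
    {x : E} (hf : ContDiffAt 𝕜 (minSmoothness 𝕜 2) f x) (u v : E) :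
    fderiv 𝕜 (fun y => fderiv 𝕜 f y v) x u = fderiv 𝕜 (fun y => fderiv 𝕜 f y u) x v := by
  have hd : DifferentiableAt 𝕜 (fderiv 𝕜 f) x :=
    ((hf.of_le le_minSmoothness).fderiv_right (m := 1) one_add_one_eq_two.le).differentiableAt
      one_ne_zero
  have hsecond : ∀ a b, fderiv 𝕜 (fun y => fderiv 𝕜 f y b) x a = fderiv 𝕜 (fderiv 𝕜 f) x a b := by
    intro a b
    rw [(hd.hasFDerivAt.clm_apply (hasFDerivAt_const b x)).fderiv]
    simp
  rw [hsecond, hsecond]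
  exact hf.isSymmSndFDerivAt le_rfl u v

section Slices

variable {P : Type*} [NormedAddCommGroup P] [NormedSpace ℝ P] {p : ℕ}

/-- The iterated partial derivative `∂_L` of the slices `k(t, ·)` of a function of `(t, x)`, as a
function of `(t, x)`. -/
noncomputable def sliceIterPartialDeriv (L : List (Fin p)) (k : P × (Fin p → ℝ) → ℝ) :
    P × (Fin p → ℝ) → ℝ :=
  fun s => iterPartialDeriv L (fun y => k (s.1, y)) s.2

variable {T : Set (P × (Fin p → ℝ))} {k : P × (Fin p → ℝ) → ℝ}

theorem sliceIterPartialDeriv_cons {L : List (Fin p)} {s : P × (Fin p → ℝ)}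
    (hd : DifferentiableAt ℝ (sliceIterPartialDeriv L k) s) (j : Fin p) :
    sliceIterPartialDeriv (j :: L) k s =
      fderiv ℝ (sliceIterPartialDeriv L k) s (0, Pi.single j 1) := by
  have hslice : HasFDerivAt (fun y => sliceIterPartialDeriv L k (s.1, y))
      ((fderiv ℝ (sliceIterPartialDeriv L k) s).comp (.inr ℝ P (Fin p → ℝ))) s.2 :=
    HasFDerivAt.comp s.2 (g := sliceIterPartialDeriv L k) hd.hasFDerivAt
      (hasFDerivAt_prodMk_right s.1 s.2)
  exact DFunLike.congr_fun hslice.fderiv (Pi.single j 1)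

theorem fderiv_apply_contDiffOn (hT : IsOpen T) (hk : ContDiffOn ℝ ∞ k T) (u : P × (Fin p → ℝ)) :
    ContDiffOn ℝ ∞ (fun s => fderiv ℝ k s u) T :=
  (hk.fderiv_of_isOpen hT (m := ∞) (by simp)).clm_apply contDiffOn_const

theorem sliceIterPartialDeriv_contDiffOn (hT : IsOpen T) (hk : ContDiffOn ℝ ∞ k T)
    (L : List (Fin p)) : ContDiffOn ℝ ∞ (sliceIterPartialDeriv L k) T := by
  induction L with
  | nil => exact hk
  | cons j L ih =>
    exact (fderiv_apply_contDiffOn hT ih _).congr fun s hs =>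
      sliceIterPartialDeriv_cons ((ih.contDiffAt (hT.mem_nhds hs)).differentiableAt (by simp)) j

theorem sliceIterPartialDeriv_differentiableAt (hT : IsOpen T) (hk : ContDiffOn ℝ ∞ k T)
    (L : List (Fin p)) {s : P × (Fin p → ℝ)} (hs : s ∈ T) :
    DifferentiableAt ℝ (sliceIterPartialDeriv L k) s :=
  ((sliceIterPartialDeriv_contDiffOn hT hk L).contDiffAt (hT.mem_nhds hs)).differentiableAt
    (by simp)

theorem sliceIterPartialDeriv_fderiv_apply (hT : IsOpen T) (hk : ContDiffOn ℝ ∞ k T)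
    (u : P × (Fin p → ℝ)) (L : List (Fin p)) :
    Set.EqOn (sliceIterPartialDeriv L fun s => fderiv ℝ k s u)
      (fun s => fderiv ℝ (sliceIterPartialDeriv L k) s u) T := by
  induction L with
  | nil => exact fun _ _ => rfl
  | cons j L ih =>
    intro s hs
    have hu := fderiv_apply_contDiffOn hT hk u
    have hcons : sliceIterPartialDeriv (j :: L) k =ᶠ[𝓝 s]
        fun s => fderiv ℝ (sliceIterPartialDeriv L k) s (0, Pi.single j 1) :=
      Filter.eventually_of_mem (hT.mem_nhds hs) fun s hs =>
        sliceIterPartialDeriv_cons (sliceIterPartialDeriv_differentiableAt hT hk L hs) j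
    calc sliceIterPartialDeriv (j :: L) (fun s => fderiv ℝ k s u) s
        = fderiv ℝ (sliceIterPartialDeriv L fun s => fderiv ℝ k s u) s (0, Pi.single j 1) :=
          sliceIterPartialDeriv_cons (sliceIterPartialDeriv_differentiableAt hT hu L hs) j
      _ = fderiv ℝ (fun s => fderiv ℝ (sliceIterPartialDeriv L k) s u) s (0, Pi.single j 1) := by
          rw [(Filter.eventuallyEq_of_mem (hT.mem_nhds hs) ih).fderiv_eq]
      _ = fderiv ℝ (fun s => fderiv ℝ (sliceIterPartialDeriv L k) s (0, Pi.single j 1)) s u :=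
          fderiv_fderiv_apply_comm (((sliceIterPartialDeriv_contDiffOn hT hk L).contDiffAt
            (hT.mem_nhds hs)).of_le
              (by rw [minSmoothness_of_isRCLikeNormedField]; exact WithTop.coe_le_coe.2 le_top)) _ _
      _ = fderiv ℝ (sliceIterPartialDeriv (j :: L) k) s u := by rw [hcons.fderiv_eq]

theorem fderiv_sliceIterPartialDeriv_apply (hT : IsOpen T) (hk : ContDiffOn ℝ ∞ k T)
    (L : List (Fin p)) {s : P × (Fin p → ℝ)} (hs : s ∈ T) (u : P) (v : Fin p → ℝ) :
    fderiv ℝ (sliceIterPartialDeriv L k) s (u, v) =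
      sliceIterPartialDeriv L (fun s => fderiv ℝ k s (u, 0)) s +
        ∑ i, v i * sliceIterPartialDeriv (i :: L) k s := by
  have hd := sliceIterPartialDeriv_differentiableAt hT hk L hs
  have hdecomp : ((u, v) : P × (Fin p → ℝ)) = (u, 0) + ∑ i, v i • (0, Pi.single i (1 : ℝ)) := by
    refine Prod.ext (by simp [Prod.fst_sum]) ?_
    simpa [Prod.snd_sum] using pi_eq_sum_univ' v
  simp only [sliceIterPartialDeriv_fderiv_apply hT hk (u, 0) L hs, sliceIterPartialDeriv_cons hd]
  rw [hdecomp, map_add, map_sum]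
  simp only [map_smul, smul_eq_mul]

theorem hasDerivAt_iterPartialDeriv_curve {T : Set (ℝ × (Fin p → ℝ))} (hT : IsOpen T)
    {k : ℝ × (Fin p → ℝ) → ℝ} (hk : ContDiffOn ℝ ∞ k T) {a : ℝ → Fin p → ℝ} {v : Fin p → ℝ}
    {t : ℝ} (ha : HasDerivAt a v t) (ht : (t, a t) ∈ T) (L : List (Fin p)) :
    HasDerivAt (fun ε => iterPartialDeriv L (fun y => k (ε, y)) (a ε))
      (iterPartialDeriv L (fun y => fderiv ℝ k (t, y) (1, 0)) (a t) +
        ∑ i, v i * iterPartialDeriv (i :: L) (fun y => k (t, y)) (a t)) t := by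
  have hd := (sliceIterPartialDeriv_differentiableAt hT hk L ht).hasFDerivAt
  have hcurve : HasDerivAt (fun ε => (ε, a ε)) (1, v) t := (hasDerivAt_id t).prodMk ha
  simpa only [fderiv_sliceIterPartialDeriv_apply hT hk L ht] using!
    hd.comp_hasDerivAt t hcurve

end Slices

namespace LocalOneParamGroup

variable {E : Type*} [NormedAddCommGroup E] [NormedSpace ℝ E] {M : Set E}
  (Φ : LocalOneParamGroup M) {ε : ℝ} {m : E}

include Φ in
theorem isOpen : IsOpen M := by
  convert Φ.isOpen_dom.preimage (Continuous.prodMk_right (0 : ℝ)) using 1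
  exact Set.Subset.antisymm Φ.zero_mem_dom (Φ.mem_of_dom 0)

theorem contDiffAt_act (hm : (ε, m) ∈ Φ.dom) : ContDiffAt ℝ ∞ (Φ.act ε) m :=
  ContDiffAt.comp (g := fun y : ℝ × E => Φ.act y.1 y.2) m
    (Φ.contDiffOn_act.contDiffAt (Φ.isOpen_dom.mem_nhds hm)) (contDiffAt_const.prodMk contDiffAt_id)

theorem act_neg_act (hm : (ε, m) ∈ Φ.dom) : Φ.act (-ε) (Φ.act ε m) = m := by
  have hmM : m ∈ M := Φ.mem_of_dom ε m hm
  rw [Φ.act_act (-ε) ε m hm (Φ.neg_mem_dom ε m hm)] <;> rw [neg_add_cancel]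
  exacts [Φ.act_zero m hmM, Φ.zero_mem_dom m hmM]

variable {Φ} in
theorem IsGeneratedBy.contDiffOn {v : E → E} (hΦ : Φ.IsGeneratedBy v) : ContDiffOn ℝ ∞ v M := by
  have hfderiv : ContDiffOn ℝ ∞ (fun m => fderiv ℝ (fun y : ℝ × E => Φ.act y.1 y.2) (0, m)) M :=
    (Φ.contDiffOn_act.fderiv_of_isOpen Φ.isOpen_dom (m := ∞) (by simp)).comp
      (contDiff_prodMk_right (0 : ℝ)).contDiffOn Φ.zero_mem_dom
  refine (hfderiv.clm_apply (contDiffOn_const (c := ((1 : ℝ), (0 : E))))).congr fun m hm => ?_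
  have hact : HasFDerivAt (fun y : ℝ × E => Φ.act y.1 y.2) _ ((0 : ℝ), m) :=
    ((Φ.contDiffOn_act.contDiffAt
      (Φ.isOpen_dom.mem_nhds (Φ.zero_mem_dom m hm))).differentiableAt (by simp)).hasFDerivAt
  have hcurve : HasDerivAt (fun ε : ℝ => (ε, m)) (1, 0) 0 :=
    (hasDerivAt_id 0).prodMk (hasDerivAt_const 0 m)
  exact (hΦ m hm).unique
    (HasFDerivAt.comp_hasDerivAt (l := fun y : ℝ × E => Φ.act y.1 y.2) (0 : ℝ) hact hcurve)

end LocalOneParamGroup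

/-- The family of functions `f_ε = F(ε, ·)` whose graphs are the images under `Φ_ε` of the graph of
`f`, jointly smooth in `(ε, y)`. The domains of `f` and `f_ε` are the slices of `source` and
`target` at `ε`. -/
structure TransformedFamily {p q : ℕ} {M : Set (BaseSpace p q)} (Φ : LocalOneParamGroup M)
    (f : (Fin p → ℝ) → Fin q → ℝ) where
  source : Set (ℝ × (Fin p → ℝ))
  target : Set (ℝ × (Fin p → ℝ))
  F : ℝ × (Fin p → ℝ) → Fin q → ℝ
  isOpen_source : IsOpen source
  isOpen_target : IsOpen target
  mem_dom : ∀ s ∈ source, (s.1, s.2, f s.2) ∈ Φ.dom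
  contDiffOn_F : ContDiffOn ℝ ∞ F target
  image_graphOn : ∀ ε, Φ.act ε '' {x | (ε, x) ∈ source}.graphOn f =
    {y | (ε, y) ∈ target}.graphOn fun y => F (ε, y)

/-- The vector field given by the prolongation formula. It is a vector field along the projection
from the `(n+1)`-st jet space to the `n`-th one, as the coefficients of the formula are a priori
functions on the former. -/
noncomputable def prolongedField {p q : ℕ} (ξ : Fin p → BaseSpace p q → ℝ)
    (φ : Fin q → BaseSpace p q → ℝ) (n : ℕ) (w : JetSpace p q (n + 1)) : JetSpace p q n :=
  (fun i => ξ i w.base, fun α J => prolongationCoeff ξ φ α J.1.toList (w.proj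
    (by rw [Multiset.length_toList, add_comm]; exact Nat.succ_le_succ J.2)))

namespace TransformedFamily

variable {p q : ℕ} {M : Set (BaseSpace p q)} {Φ : LocalOneParamGroup M}
  {f : (Fin p → ℝ) → Fin q → ℝ}

theorem image_graphOn_of_openPartialHomeomorph {g : ℝ → BaseSpace p q → BaseSpace p q}
    {e : OpenPartialHomeomorph (ℝ × (Fin p → ℝ)) (ℝ × (Fin p → ℝ))}
    (he : ⇑e = fun s => (s.1, (g s.1 (s.2, f s.2)).1)) (ε : ℝ) :
    g ε '' {x | (ε, x) ∈ e.source}.graphOn f =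
      {y | (ε, y) ∈ e.target}.graphOn
        fun y => (g (e.symm (ε, y)).1 ((e.symm (ε, y)).2, f (e.symm (ε, y)).2)).2 := by
  have he' : ∀ s, e s = (s.1, (g s.1 (s.2, f s.2)).1) := congrFun he
  apply Set.Subset.antisymm
  · rintro _ ⟨_, ⟨x, hx, rfl⟩, rfl⟩
    have htarget := e.map_source hx
    have hinv := e.left_inv hx
    rw [he'] at htarget hinv
    exact Set.mem_graphOn.2 ⟨htarget, by simp only [hinv]⟩
  · rintro _ ⟨y, hy, rfl⟩
    have hsource := e.map_target hy
    have hinv := e.right_inv hy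
    rw [he'] at hinv
    beta_reduce
    generalize e.symm (ε, y) = s at hsource hinv ⊢
    obtain ⟨rfl, rfl⟩ := Prod.ext_iff.1 hinv
    exact ⟨_, ⟨s.2, hsource, rfl⟩, rfl⟩

variable (Φ) in
theorem exists_zero_mem_source (hf : ContDiff ℝ ∞ f) {x₀ : Fin p → ℝ} (hx₀ : (x₀, f x₀) ∈ M) :
    ∃ T : TransformedFamily Φ f, (0, x₀) ∈ T.source := by
  have hgraph : ContDiff ℝ ∞ fun s : ℝ × (Fin p → ℝ) => (s.1, s.2, f s.2) := by fun_prop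
  have hact : ContDiffOn ℝ ∞ (fun s : ℝ × (Fin p → ℝ) => Φ.act s.1 (s.2, f s.2))
      ((fun s => (s.1, s.2, f s.2)) ⁻¹' Φ.dom) :=
    Φ.contDiffOn_act.comp hgraph.contDiffOn fun _ hs => hs
  have hid : (fun x => (Φ.act 0 (x, f x)).1) =ᶠ[𝓝 x₀] id :=
    Filter.mem_of_superset ((Φ.isOpen.preimage
      (continuous_id.prodMk hf.continuous)).mem_nhds hx₀) fun x hx =>
        congrArg Prod.fst (Φ.act_zero (x, f x) hx)
  obtain ⟨e, he, h₀, hdom, hsymm⟩ := exists_openPartialHomeomorph_prodMk (by simp)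
    (Φ.isOpen_dom.preimage hgraph.continuous) hact.fst (t₀ := 0) (Φ.zero_mem_dom _ hx₀)
    (a' := .refl ℝ _) ((hasFDerivAt_id x₀).congr_of_eventuallyEq hid)
  exact ⟨{  source := e.source
            target := e.target
            F := fun s => (Φ.act (e.symm s).1 ((e.symm s).2, f (e.symm s).2)).2
            isOpen_source := e.open_source
            isOpen_target := e.open_target
            mem_dom := fun s hs => hdom hs
            contDiffOn_F := (hact.comp hsymm fun s hs => hdom (e.map_target hs)).snd
            image_graphOn := image_graphOn_of_openPartialHomeomorph he }, h₀⟩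

variable (T : TransformedFamily Φ f) {ε : ℝ} {x : Fin p → ℝ} {n : ℕ}

theorem isOpen_source_slice (ε : ℝ) : IsOpen {x | (ε, x) ∈ T.source} :=
  T.isOpen_source.preimage (Continuous.prodMk_right ε)

theorem isOpen_target_slice (ε : ℝ) : IsOpen {y | (ε, y) ∈ T.target} :=
  T.isOpen_target.preimage (Continuous.prodMk_right ε)

theorem contDiffOn_F_slice (ε : ℝ) :
    ContDiffOn ℝ ∞ (fun y => T.F (ε, y)) {y | (ε, y) ∈ T.target} :=
  T.contDiffOn_F.comp (contDiff_prodMk_right ε).contDiffOn fun _ hy => hy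

theorem eventually_mem_source (hx : (0, x) ∈ T.source) : ∀ᶠ ε in 𝓝 0, (ε, x) ∈ T.source :=
  (T.isOpen_source.preimage (Continuous.prodMk_left x)).mem_nhds hx

theorem F_act_fst (hx : (ε, x) ∈ T.source) :
    T.F (ε, (Φ.act ε (x, f x)).1) = (Φ.act ε (x, f x)).2 :=
  (fst_mem_and_apply_fst_eq_of_image_graphOn (T.image_graphOn ε) hx).2

theorem mem_of_zero_mem_source (hx : (0, x) ∈ T.source) : (x, f x) ∈ M :=
  Φ.mem_of_dom 0 _ (T.mem_dom _ hx)

theorem zero_mem_target (hx : (0, x) ∈ T.source) : (0, x) ∈ T.target := by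
  have hmem := (fst_mem_and_apply_fst_eq_of_image_graphOn (T.image_graphOn 0) hx).1
  rwa [Φ.act_zero _ (T.mem_of_zero_mem_source hx)] at hmem

theorem F_zero (hx : (0, x) ∈ T.source) : T.F (0, x) = f x := by
  simpa only [Φ.act_zero _ (T.mem_of_zero_mem_source hx)] using T.F_act_fst hx

theorem prolongedMapsTo (hf : ContDiff ℝ ∞ f) (n : ℕ) (hx : (ε, x) ∈ T.source) :
    ProlongedMapsTo n (Φ.act ε) (Φ.domAt ε) (jetAt n f x)
      (jetAt n (fun y => T.F (ε, y)) (Φ.act ε (x, f x)).1) := by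
  refine ⟨{x | (ε, x) ∈ T.source}, {y | (ε, y) ∈ T.target}, f, fun y => T.F (ε, y),
    T.isOpen_source_slice ε, hx, hf.contDiffOn, ?_, rfl, T.isOpen_target_slice ε,
    T.contDiffOn_F_slice ε, T.image_graphOn ε, by rw [jetAt_base]⟩
  rintro _ ⟨y, hy, rfl⟩
  exact T.mem_dom _ hy

theorem prolongedMapsTo_iff (hf : ContDiff ℝ ∞ f) (hx : (ε, x) ∈ T.source)
    {z : JetSpace p q n} : ProlongedMapsTo n (Φ.act ε) (Φ.domAt ε) (jetAt n f x) z ↔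
      z = jetAt n (fun y => T.F (ε, y)) (Φ.act ε (x, f x)).1 := by
  refine ⟨fun hz => ?_, fun hz => hz ▸ T.prolongedMapsTo hf n hx⟩
  have hdom : (ε, (jetAt n f x).base) ∈ Φ.dom := jetAt_base n f x ▸ T.mem_dom _ hx
  exact hz.unique (Φ.contDiffAt_act hdom) (Φ.contDiffAt_act (Φ.neg_mem_dom _ _ hdom))
    (fun m hm => Φ.act_neg_act hm) (T.prolongedMapsTo hf n hx)

variable {ξ : Fin p → BaseSpace p q → ℝ} {φ : Fin q → BaseSpace p q → ℝ}

theorem hasDerivAt_iterPartialDeriv_F (hΦ : Φ.IsGeneratedBy (vectorField ξ φ)) (α : Fin q)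
    (L : List (Fin p)) (hx : (0, x) ∈ T.source) :
    HasDerivAt
      (fun ε => iterPartialDeriv L (fun y => T.F (ε, y) α) (Φ.act ε (x, f x)).1)
      (iterPartialDeriv L (fun y => fderiv ℝ (fun s => T.F s α) (0, y) (1, 0)) x +
        ∑ i, ξ i (x, f x) * iterPartialDeriv (i :: L) (fun y => f y α) x) 0 := by
  have hxM : (x, f x) ∈ M := T.mem_of_zero_mem_source hx
  have hcurve := hasDerivAt_iterPartialDeriv_curve T.isOpen_target
    (contDiffOn_pi.1 T.contDiffOn_F α) (hΦ _ hxM).fst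
    (by simpa only [Φ.act_zero _ hxM] using T.zero_mem_target hx) L
  have hF_zero : ∀ i, iterPartialDeriv (i :: L) (fun y => T.F (0, y) α) x =
      iterPartialDeriv (i :: L) (fun y => f y α) x := fun i =>
    iterPartialDeriv_congr (T.isOpen_source_slice 0) (i :: L)
      (fun y hy => congrFun (T.F_zero hy) α) hx
  simpa only [Φ.act_zero _ hxM, hF_zero] using! hcurve

/-- Differentiate `F(ε, a ε) = (Φ_ε (x, f x)).2` at `ε = 0`, where `a ε = (Φ_ε (x, f x)).1`. -/
theorem fderiv_F_zero (hΦ : Φ.IsGeneratedBy (vectorField ξ φ)) (α : Fin q)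
    (hx : (0, x) ∈ T.source) :
    fderiv ℝ (fun s => T.F s α) (0, x) (1, 0) = characteristic ξ φ α (jetAt 1 f x) := by
  have hF := T.hasDerivAt_iterPartialDeriv_F hΦ α [] hx
  have hφ : HasDerivAt (fun ε => (Φ.act ε (x, f x)).2 α) (φ α (x, f x)) 0 :=
    hasDerivAt_pi.1 (hΦ _ (T.mem_of_zero_mem_source hx)).snd α
  have hsum := hφ.unique (hF.congr_of_eventuallyEq
    ((T.eventually_mem_source hx).mono fun ε hε => (congrFun (T.F_act_fst hε) α).symm))
  rw [characteristic_jetAt]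
  exact eq_sub_of_add_eq hsum.symm

theorem hasDerivAt_jetAt (hΦ : Φ.IsGeneratedBy (vectorField ξ φ)) (hf : ContDiff ℝ ∞ f) (n : ℕ)
    (hx : (0, x) ∈ T.source) :
    HasDerivAt (fun ε => jetAt n (fun y => T.F (ε, y)) (Φ.act ε (x, f x)).1)
      (prolongedField ξ φ n (jetAt (n + 1) f x)) 0 := by
  refine HasDerivAt.prodMk ?_ (hasDerivAt_pi.2 fun α => hasDerivAt_pi.2 fun J => ?_)
  · simpa only [jetAt_base] using! (hΦ _ (T.mem_of_zero_mem_source hx)).fst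
  · refine (T.hasDerivAt_iterPartialDeriv_F hΦ α J.1.toList hx).congr_deriv ?_
    rw [iterPartialDeriv_congr (T.isOpen_source_slice 0) J.1.toList
      (fun y hy => T.fderiv_F_zero hΦ α hy) hx]
    exact (prolongationCoeff_jetAt Φ.isOpen hΦ.contDiffOn (T.isOpen_source_slice 0) hf.contDiffOn
      (fun y hy => T.mem_of_zero_mem_source hy) α J.1.toList hx).symm

end TransformedFamily

namespace JetSpace

variable {p q n : ℕ} (z : JetSpace p q n)

/-- A smooth section of the projection from the `(n+1)`-st jet space to the `n`-th one: the
coordinates of order `n + 1` are set to zero. -/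
noncomputable def lift : JetSpace p q (n + 1) :=
  (z.1, fun α J => if h : J.1.card ≤ n then z.2 α ⟨J.1, h⟩ else 0)

theorem proj_lift : z.lift.proj n.le_succ = z :=
  Prod.ext rfl (funext₂ fun _ J => dif_pos J.2)

theorem base_lift : z.lift.base = z.base :=
  congrArg base z.proj_lift

theorem lift_mem_jetsOver {M : Set (BaseSpace p q)} {z : JetSpace p q n} (hz : z ∈ jetsOver M n) :
    z.lift ∈ jetsOver M (n + 1) := by
  rwa [jetsOver, Set.mem_ofPred_eq, base_lift]

theorem contDiff_lift : ContDiff ℝ ∞ (lift : JetSpace p q n → JetSpace p q (n + 1)) := by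
  refine contDiff_fst.prodMk (contDiff_pi.2 fun α => contDiff_pi.2 fun J => ?_)
  by_cases h : J.1.card ≤ n
  · simp only [h, dif_pos]
    fun_prop
  · simp only [h, dif_neg, not_false_eq_true]
    fun_prop

end JetSpace

section Prolongation

variable {p q n : ℕ} {M : Set (BaseSpace p q)} {ξ : Fin p → BaseSpace p q → ℝ}
  {φ : Fin q → BaseSpace p q → ℝ} {Φ : LocalOneParamGroup M}

theorem prolongedField_contDiffOn (hM : IsOpen M) (hv : ContDiffOn ℝ ∞ (vectorField ξ φ) M) :
    ContDiffOn ℝ ∞ (prolongedField ξ φ n) (JetSpace.jetsOver M (n + 1)) :=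
  (hv.fst.comp JetSpace.contDiff_base.contDiffOn fun _ hw => hw).prodMk <|
    contDiffOn_pi.2 fun α => contDiffOn_pi.2 fun J =>
      (prolongationCoeff_contDiffOn hM hv α J.1.toList).comp
        (JetSpace.contDiff_proj _).contDiffOn fun _ hw => hw

theorem exists_hasDerivAt_and_prolongedMapsTo_iff (hΦ : Φ.IsGeneratedBy (vectorField ξ φ))
    {w : JetSpace p q (n + 1)} (hw : w ∈ JetSpace.jetsOver M (n + 1)) :
    ∃ c : ℝ → JetSpace p q n, HasDerivAt c (prolongedField ξ φ n w) 0 ∧ ∀ᶠ ε in 𝓝 (0 : ℝ), ∀ z,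
      ProlongedMapsTo n (Φ.act ε) (Φ.domAt ε) (w.proj n.le_succ) z ↔ z = c ε := by
  obtain ⟨f, hf, hfw⟩ := exists_contDiff_jetAt_eq w
  obtain ⟨T, hT⟩ := TransformedFamily.exists_zero_mem_source Φ hf
    (jetAt_mem_jetsOver.1 (hfw.symm ▸ hw))
  refine ⟨_, hfw ▸ T.hasDerivAt_jetAt hΦ hf n hT, ?_⟩
  filter_upwards [T.eventually_mem_source hT] with ε hε z
  rw [← T.prolongedMapsTo_iff hf hε, ← hfw]
  rfl

theorem isProlongation_prolongedField_lift (hΦ : Φ.IsGeneratedBy (vectorField ξ φ)) :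
    IsProlongation Φ n fun z => prolongedField ξ φ n z.lift := by
  intro z hz
  have hw : z.lift ∈ JetSpace.jetsOver M (n + 1) := JetSpace.lift_mem_jetsOver hz
  obtain ⟨c₀, hc₀, hiff⟩ := exists_hasDerivAt_and_prolongedMapsTo_iff hΦ hw
  rw [z.proj_lift] at hiff
  refine ⟨hiff.mono fun ε hε => ⟨c₀ ε, (hε _).2 rfl, fun z' => (hε z').1⟩, fun c hc => ?_⟩
  exact hc₀.congr_of_eventuallyEq ((hiff.and hc).mono fun ε hε => (hε.1 _).1 hε.2)

variable {V : JetSpace p q n → JetSpace p q n}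

theorem IsProlongation.apply_proj (hV : IsProlongation Φ n V)
    (hΦ : Φ.IsGeneratedBy (vectorField ξ φ)) {w : JetSpace p q (n + 1)}
    (hw : w ∈ JetSpace.jetsOver M (n + 1)) : V (w.proj n.le_succ) = prolongedField ξ φ n w := by
  obtain ⟨c, hc, hiff⟩ := exists_hasDerivAt_and_prolongedMapsTo_iff hΦ hw
  exact ((hV _ hw).2 c (hiff.mono fun ε hε => (hε _).2 rfl)).unique hc

theorem IsProlongation.apply (hV : IsProlongation Φ n V)
    (hΦ : Φ.IsGeneratedBy (vectorField ξ φ)) {z : JetSpace p q n}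
    (hz : z ∈ JetSpace.jetsOver M n) : V z = prolongedField ξ φ n z.lift := by
  rw [← hV.apply_proj hΦ (JetSpace.lift_mem_jetsOver hz), z.proj_lift]

theorem IsProlongation.contDiffOn (hV : IsProlongation Φ n V)
    (hΦ : Φ.IsGeneratedBy (vectorField ξ φ)) : ContDiffOn ℝ ∞ V (JetSpace.jetsOver M n) :=
  ((prolongedField_contDiffOn Φ.isOpen hΦ.contDiffOn).comp JetSpace.contDiff_lift.contDiffOn
    fun _ => JetSpace.lift_mem_jetsOver).congr fun _ hz => hV.apply hΦ hz

theorem IsProlongation.coeff_eq (hV : IsProlongation Φ n V)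
    (hΦ : Φ.IsGeneratedBy (vectorField ξ φ)) {w : JetSpace p q (n + 1)}
    (hw : w ∈ JetSpace.jetsOver M (n + 1)) (α : Fin q) (L : List (Fin p)) (hL : L.length ≤ n) :
    (V (w.proj n.le_succ)).2 α ⟨(L : Multiset (Fin p)), hL⟩ =
      prolongationCoeff ξ φ α L (w.proj ((add_comm 1 _).trans_le (Nat.succ_le_succ hL))) := by
  rw [hV.apply_proj hΦ hw]
  exact prolongationCoeff_perm Φ.isOpen hΦ.contDiffOn α
    (Multiset.coe_eq_coe.1 (Multiset.coe_toList _)) hw _ _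

theorem IsProlongation.base_apply (hV : IsProlongation Φ n V)
    (hΦ : Φ.IsGeneratedBy (vectorField ξ φ)) {z : JetSpace p q n}
    (hz : z ∈ JetSpace.jetsOver M n) : (V z).base = vectorField ξ φ z.base := by
  have hw : z.lift ∈ JetSpace.jetsOver M (n + 1) := JetSpace.lift_mem_jetsOver hz
  have hfst := congrArg Prod.fst (hV.apply_proj hΦ hw)
  rw [← z.proj_lift]
  refine Prod.ext hfst (funext fun α => ?_)
  exact (hV.coeff_eq hΦ hw α [] n.zero_le).trans (prolongationCoeff_nil α _)

end Prolongation

theorem mainTheorem8 {p q : ℕ} (M : Set (BaseSpace p q)) (hM : IsOpen M)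
    (ξ : Fin p → BaseSpace p q → ℝ) (φ : Fin q → BaseSpace p q → ℝ)
    (hξ : ∀ i, ContDiffOn ℝ ∞ (ξ i) M) (hφ : ∀ α, ContDiffOn ℝ ∞ (φ α) M)
    (Φ : LocalOneParamGroup M) (hΦ : Φ.IsGeneratedBy (vectorField ξ φ)) (n : ℕ) :
    (∃ V : JetSpace p q n → JetSpace p q n, IsProlongation Φ n V) ∧
    ∀ V : JetSpace p q n → JetSpace p q n, IsProlongation Φ n V →
      ContDiffOn ℝ ∞ V (JetSpace.jetsOver M n) ∧
      (∀ z ∈ JetSpace.jetsOver M n,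
        (∀ i, (V z).1 i = ξ i z.base) ∧
        (∀ α, (V z).2 α ⟨0, Nat.zero_le n⟩ = φ α z.base)) ∧
      -- the coefficient of `∂/∂u^α_J`; as the formula a priori lives on a jet space of order up to
      -- `n + 1`, it is evaluated at an arbitrary point `w` of `M^(n+1)` above the point of `M^(n)`
      ∀ w ∈ JetSpace.jetsOver M (n + 1), ∀ (α : Fin q) (L : List (Fin p)) (hL : L.length ≤ n),
        (V (w.proj n.le_succ)).2 α ⟨(L : Multiset (Fin p)), hL⟩ =
          prolongationCoeff ξ φ α L (w.proj (show 1 + L.length ≤ n + 1 by omega)) := by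
  refine ⟨⟨_, isProlongation_prolongedField_lift hΦ⟩, fun V hV =>
    ⟨hV.contDiffOn hΦ, fun z hz => ?_, fun w hw => hV.coeff_eq hΦ hw⟩⟩
  have hbase : (V z).base = vectorField ξ φ z.base := hV.base_apply hΦ hz
  exact ⟨fun i => congrFun (congrArg Prod.fst hbase) i,
    fun α => congrFun (congrArg Prod.snd hbase) α⟩
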